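/- Let $V\subset\mathbb{R}^2$ be a finite set of points and let $r>0$. For $v\in V$ let $B(v,r/2)$ be the closed disc of radius $r/2$ about $v$, let $\mathrm{Vor}(v)=\{x\in\mathbb{R}^2 : |x-v|\le|x-w| \text{ for all } w\in V\}$ be its closed Voronoi cell, and let $\alpha(v,r)=\mathrm{Vor}(v)\cap B(v,r/2)$. All complexes below are abstract simplicial complexes on the vertex set $V$. - The alpha complex $A_r$ is the nerve of the sets $\alpha(v,r)$, $v\in V$: a nonempty $\sigma\subseteq V$ is a simplex if and only if $\bigcap_{v\in\sigma}\alpha(v,r)\neq\varnothing$. - The Čech complex $\check{C}(V,r)$ is the nerve of the discs $B(v,r/2)$, $v\in V$. - $DT(V)$ is the Delaunay complex: a nonempty $\sigma\subseteq V$ is a simplex if and only if some circle (of radius $\ge 0$) passes through all points of $\sigma$ and has no point of $V$ strictly inside it. (It is the nerve of the Voronoi cells; if no four points of $V$ lie on a circle with no point of $V$ inside, it is the Delaunay triangulation of $V$.) - The Delaunay–Čech complex is $D\check{C}_r=DT(V)\cap\check{C}(V,r)$. Then $D\check{C}_r$ and $A_r$ are homotopy equivalent, i.e. their geometric realizations are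 homotopy equivalent topological spaces. -/

import Mathlib

/-- The Euclidean plane. -/
abbrev Plane : Type := EuclideanSpace ℝ (Fin 2)

/-- The nerve of a family of sets: a nonempty finite set of indices is a face when the
corresponding members of the family have a common point. -/
def nerveComplex {ι X : Type*} (C : ι → Set X) : PreAbstractSimplicialComplex ι where
  faces := {s | s.Nonempty ∧ (⋂ i ∈ s, C i).Nonempty}
  isRelLowerSet_faces := by
    rintro s ⟨hs, x, hx⟩
    refine ⟨hs, fun t hts ht => ⟨ht, x, ?_⟩⟩
    simp only [Set.mem_iInter] at hx ⊢
    exact fun i hi => hx i (hts hi)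

/-- The (closed) Voronoi cell of `v` in the Voronoi decomposition of the plane induced by `V`. -/
def voronoiCell (V : Finset Plane) (v : V) : Set Plane :=
  {x | ∀ w ∈ V, dist x v ≤ dist x w}

/-- The alpha cell of `v`: the part of its Voronoi cell within distance `r / 2` of `v`. -/
def alphaCell (V : Finset Plane) (r : ℝ) (v : V) : Set Plane :=
  voronoiCell V v ∩ Metric.closedBall (v : Plane) (r / 2)

/-- The alpha complex `A_r`: the nerve of the alpha cells. -/
def alphaComplex (V : Finset Plane) (r : ℝ) : PreAbstractSimplicialComplex V :=
  nerveComplex (alphaCell V r)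

/-- The Čech complex `Č(V, r)`: the nerve of the closed balls of radius `r / 2` about `V`. -/
def cechComplex (V : Finset Plane) (r : ℝ) : PreAbstractSimplicialComplex V :=
  nerveComplex fun v : V => Metric.closedBall (v : Plane) (r / 2)

/-- The Delaunay triangulation `DT(V)`, as an abstract complex, by the empty circle property:
points of `V` span a simplex when some circle passes through all of them and has no point of `V`
inside it (a circle of radius `0` is allowed, which only matters for single vertices).
If no four points of `V` lie on a circle with no point of `V` inside it, this is the usual
Delaunay triangulation; in general it is the Delaunay complex, the dual of the Voronoi
decomposition (see `delaunayComplex_eq_nerveComplex_voronoiCell`). -/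
def delaunayComplex (V : Finset Plane) : PreAbstractSimplicialComplex V where
  faces := {s | s.Nonempty ∧ ∃ (c : Plane) (ρ : ℝ),
    (∀ v ∈ s, (v : Plane) ∈ Metric.sphere c ρ) ∧ ∀ w ∈ V, w ∉ Metric.ball c ρ}
  isRelLowerSet_faces := by
    rintro s ⟨hs, c, ρ, hsph, hemp⟩
    exact ⟨hs, fun t hts ht => ⟨ht, c, ρ, fun v hv => hsph v (hts hv), hemp⟩⟩

theorem delaunayComplex_eq_nerveComplex_voronoiCell (V : Finset Plane) :
    delaunayComplex V = nerveComplex (voronoiCell V) := by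
  ext s
  constructor
  · rintro ⟨hs, c, ρ, hsph, hemp⟩
    refine ⟨hs, c, ?_⟩
    simp only [Set.mem_iInter]
    intro v hv w hw
    have h1 := hsph v hv
    have h2 := hemp w hw
    rw [Metric.mem_sphere, dist_comm] at h1
    rw [Metric.mem_ball, not_lt, dist_comm] at h2
    rw [h1]
    exact h2
  · rintro ⟨hs, c, hc⟩
    simp only [Set.mem_iInter] at hc
    obtain ⟨u, hu⟩ := hs
    refine ⟨⟨u, hu⟩, c, dist c u, fun v hv => ?_, fun w hw => ?_⟩
    · rw [Metric.mem_sphere, dist_comm]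
      exact le_antisymm (hc v hv u u.2) (hc u hu v v.2)
    · rw [Metric.mem_ball, not_lt, dist_comm w c]
      exact hc u hu w hw

/-- The Delaunay–Čech complex `DČ_r = DT(V) ∩ Č(V, r)`. -/
def delaunayCechComplex (V : Finset Plane) (r : ℝ) : PreAbstractSimplicialComplex V :=
  delaunayComplex V ⊓ cechComplex V r

/-- The geometric realization of an abstract simplicial complex on a finite vertex set, as a
subspace of `ι → ℝ`: points are given by their barycentric coordinates, and the vertices with
a nonzero coordinate lie in a common face. -/
def geomRealization {ι : Type*} [Fintype ι] (K : PreAbstractSimplicialComplex ι) :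
    Set (ι → ℝ) :=
  {x | x ∈ stdSimplex ℝ ι ∧ ∃ s ∈ K.faces, ∀ i, x i ≠ 0 → i ∈ s}

/-!
Since `A_r` is a subcomplex of `DČ_r`, it suffices to remove the simplices of `DČ_r` that are not in
`A_r` by steps that preserve the homotopy type. If the link of a face `τ` is a cone with apex `w`,
then the open star of `τ` can be removed: in barycentric coordinates, moving weight from all
vertices of `τ` to `w` at the same speed, until one of them has no weight left, is a deformation
retraction (`nonempty_homotopyEquiv_of_remove_star`).

An edge of `DČ_r` is bad if it is not in `A_r`. The faces of `A_r` are the faces of `DČ_r` without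
bad edges (`mem_alphaComplex_faces_iff`): points on an empty circle of radius `R > r / 2` that also
lie in a disc of radius `r / 2` form only obtuse triangles (`exists_inner_neg`), and the longest side
of an obtuse triangle has no empty circle smaller than the circumcircle (`dist_circumcenter_le`), so
it is bad.

The open stars of the bad edges are removed in the order of decreasing radius of the smallest empty
circle, and of decreasing length among edges with the same radius. The smallest empty circle through
a bad edge `uv` contains a third point `w` of `V`, with an obtuse angle over `uv` (`exists_apex`).
This `w` is an apex of the link of `uv` at the time when `uv` is removed (`exists_cone_apex`). For let
`σ` be a face that contains `uv` and is still present. If for some vertex `z` of `σ` the triangle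
`uvz` had another longest side, this side would come before `uv` in the order and would have been
removed, together with `σ`. So all other vertices of `σ` have obtuse angles over `uv`; then they lie
on the smallest empty circle through `uv` and, like `w`, in the disc with diameter `uv`, so `σ` with
`w` added is a face of `DČ_r`. It contains no removed edge, because the edges at `w` are shorter than
`uv` and lie on the same empty circle. No general position is needed: cocircular points only make
the faces `σ` larger.
-/

/-! ### Removing the open star of a face whose link is a cone -/

/-- A flow on barycentric coordinates: the part `t * min_{i ∈ τ} x i` of the weight of each vertex
of `τ` is moved to the vertex `w`. At time `1` some vertex of `τ` has lost all its weight. -/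
def pushToApex {ι : Type*} [DecidableEq ι] (τ : Finset ι) (hτ : τ.Nonempty) (w : ι)
    (t : ℝ) (x : ι → ℝ) : ι → ℝ :=
  fun i => x i + t * τ.inf' hτ x * ((if i = w then (τ.card : ℝ) else 0) - if i ∈ τ then 1 else 0)

lemma continuous_pushToApex {ι : Type*} [DecidableEq ι] (τ : Finset ι) (hτ : τ.Nonempty) (w : ι) :
    Continuous fun p : ℝ × (ι → ℝ) => pushToApex τ hτ w p.1 p.2 := by
  have h : Continuous fun p : ℝ × (ι → ℝ) => τ.inf' hτ p.2 :=
    Continuous.finset_inf'_apply hτ fun i _ => (continuous_apply i).comp continuous_snd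
  refine continuous_pi fun i => ?_
  unfold pushToApex
  exact ((continuous_apply i).comp continuous_snd).add
    ((continuous_fst.mul h).mul continuous_const)

lemma pushToApex_zero {ι : Type*} [DecidableEq ι] (τ : Finset ι) (hτ : τ.Nonempty) (w : ι)
    (x : ι → ℝ) : pushToApex τ hτ w 0 x = x := by
  ext i
  simp [pushToApex]

lemma pushToApex_eq_self {ι : Type*} [DecidableEq ι] {τ : Finset ι} (hτ : τ.Nonempty) (w : ι)
    (t : ℝ) {x : ι → ℝ} (hx : ∀ i, 0 ≤ x i) {i : ι} (hi : i ∈ τ) (hi0 : x i = 0) :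
    pushToApex τ hτ w t x = x := by
  have h : τ.inf' hτ x = 0 :=
    le_antisymm (hi0 ▸ Finset.inf'_le x hi) (Finset.le_inf' _ _ fun j _ => hx j)
  ext i
  simp [pushToApex, h]

lemma pushToApex_mem_stdSimplex {ι : Type*} [Fintype ι] [DecidableEq ι] {τ : Finset ι}
    (hτ : τ.Nonempty) {w : ι} (hw : w ∉ τ) {t : ℝ} (ht : t ∈ Set.Icc (0 : ℝ) 1) {x : ι → ℝ}
    (hx : x ∈ stdSimplex ℝ ι) : pushToApex τ hτ w t x ∈ stdSimplex ℝ ι := by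
  have hm : 0 ≤ τ.inf' hτ x := Finset.le_inf' _ _ fun j _ => hx.1 j
  refine ⟨fun i => ?_, ?_⟩
  · unfold pushToApex
    by_cases hi : i ∈ τ
    · have hiw : i ≠ w := fun h => hw (h ▸ hi)
      have h1 : τ.inf' hτ x ≤ x i := Finset.inf'_le x hi
      have h2 : t * τ.inf' hτ x ≤ τ.inf' hτ x := mul_le_of_le_one_left hm ht.2
      simp only [hiw, hi, if_true, if_false]
      linarith
    · simp only [hi, if_false, sub_zero]
      have := hx.1 i
      have := mul_nonneg ht.1 hm
      split_ifs <;> positivity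
  · have h0 : ∑ i, ((if i = w then (τ.card : ℝ) else 0) - if i ∈ τ then (1 : ℝ) else 0) = 0 := by
      simp [Finset.sum_sub_distrib]
    simp only [pushToApex, Finset.sum_add_distrib, ← Finset.mul_sum, h0, hx.2]
    simp

/-- If the link of the face `τ` in `K` is a cone with apex `w`, then `K` deformation retracts
onto the complement `L` of the open star of `τ`. -/
theorem nonempty_homotopyEquiv_of_remove_star {ι : Type*} [Fintype ι] [DecidableEq ι]
    (K L : PreAbstractSimplicialComplex ι) {τ : Finset ι} (hτ : τ.Nonempty) {w : ι} (hw : w ∉ τ)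
    (hcone : ∀ σ ∈ K.faces, τ ⊆ σ → insert w σ ∈ K.faces)
    (hL : ∀ σ, σ ∈ L.faces ↔ σ ∈ K.faces ∧ ¬ τ ⊆ σ) :
    Nonempty (ContinuousMap.HomotopyEquiv (geomRealization K) (geomRealization L)) := by
  have hsub : ∀ x ∈ geomRealization L, x ∈ geomRealization K := by
    rintro x ⟨hx, s, hs, h⟩
    exact ⟨hx, s, ((hL s).1 hs).1, h⟩
  have hfix : ∀ x ∈ geomRealization L, ∀ t, pushToApex τ hτ w t x = x := by
    rintro x ⟨hx, s, hs, h⟩ t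
    obtain ⟨i, hi, his⟩ := Finset.not_subset.1 ((hL s).1 hs).2
    exact pushToApex_eq_self hτ w t hx.1 hi (by by_contra h0; exact his (h i h0))
  have hsupp : ∀ (x : ι → ℝ) (s : Finset ι), τ ⊆ s → (∀ i, x i ≠ 0 → i ∈ s) → ∀ t i,
      pushToApex τ hτ w t x i ≠ 0 → i ∈ insert w s := by
    intro x s hs h t i hi
    by_contra hi'
    rw [Finset.mem_insert, not_or] at hi'
    have h0 : x i = 0 := by by_contra h0; exact hi'.2 (h i h0)
    have h1 : i ∉ τ := fun h1 => hi'.2 (hs h1)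
    exact hi (by simp [pushToApex, h0, h1, hi'.1])
  have hK : ∀ t ∈ Set.Icc (0 : ℝ) 1, ∀ x ∈ geomRealization K,
      pushToApex τ hτ w t x ∈ geomRealization K := by
    rintro t ht x ⟨hx, s, hs, h⟩
    refine ⟨pushToApex_mem_stdSimplex hτ hw ht hx, ?_⟩
    by_cases hτs : τ ⊆ s
    · exact ⟨insert w s, hcone s hs hτs, hsupp x s hτs h t⟩
    · exact ⟨s, hs, by rwa [hfix x ⟨hx, s, (hL s).2 ⟨hs, hτs⟩, h⟩ t]⟩
  have hK1 : ∀ x ∈ geomRealization K, pushToApex τ hτ w 1 x ∈ geomRealization L := by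
    rintro x ⟨hx, s, hs, h⟩
    by_cases hτs : τ ⊆ s
    · refine ⟨pushToApex_mem_stdSimplex hτ hw ⟨zero_le_one, le_rfl⟩ hx, ?_⟩
      obtain ⟨i, hi, him⟩ := Finset.exists_mem_eq_inf' hτ x
      have hiw : i ≠ w := fun h => hw (h ▸ hi)
      have hi0 : pushToApex τ hτ w 1 x i = 0 := by simp [pushToApex, him, hiw, hi]
      refine ⟨(insert w s).erase i, (hL _).2 ⟨?_, fun hh => by simpa using hh hi⟩, fun j hj => ?_⟩
      · exact (K.isRelLowerSet_faces (hcone s hs hτs)).2 (Finset.erase_subset _ _)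
          ⟨w, by simp [hiw.symm]⟩
      · exact Finset.mem_erase.2 ⟨fun hji => hj (hji ▸ hi0), hsupp x s hτs h 1 j hj⟩
    · have hxL : x ∈ geomRealization L := ⟨hx, s, (hL s).2 ⟨hs, hτs⟩, h⟩
      rwa [hfix x hxL]
  have hc := continuous_pushToApex τ hτ w
  let f : C(geomRealization K, geomRealization L) :=
    ⟨fun x => ⟨pushToApex τ hτ w 1 x, hK1 x x.2⟩,
      (hc.comp (continuous_const.prodMk continuous_subtype_val)).subtype_mk _⟩
  let g : C(geomRealization L, geomRealization K) :=
    ⟨fun x => ⟨x, hsub x x.2⟩, continuous_subtype_val.subtype_mk _⟩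
  refine ⟨⟨f, g, ContinuousMap.Homotopic.symm ⟨⟨⟨fun p => ⟨pushToApex τ hτ w p.1 p.2,
    hK p.1 p.1.2 p.2 p.2.2⟩, ?_⟩, ?_, ?_⟩⟩, ?_⟩⟩
  · exact (hc.comp ((continuous_subtype_val.comp continuous_fst).prodMk
      (continuous_subtype_val.comp continuous_snd))).subtype_mk _
  · intro x
    exact Subtype.ext (pushToApex_zero τ hτ w x)
  · intro x
    rfl
  · have : f.comp g = ContinuousMap.id _ := by
      ext x : 2
      exact hfix x x.2 1
    rw [this]

/-! ### Triangles in the plane -/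

lemma plane_inner (x y : Plane) : inner ℝ x y = x 0 * y 0 + x 1 * y 1 := by
  simp [PiLp.inner_apply, Fin.sum_univ_two, mul_comm]

lemma plane_dist_sq (x y : Plane) : dist x y ^ 2 = (x 0 - y 0) ^ 2 + (x 1 - y 1) ^ 2 := by
  rw [EuclideanSpace.dist_eq, Real.sq_sqrt (by positivity)]
  simp [Fin.sum_univ_two, Real.dist_eq, sq_abs]

/-- The angle at `z` over the segment `uv` is obtuse if and only if `z` is inside the disc with
diameter `uv`. -/
lemma inner_sub_sub_eq_dist_midpoint (u v z : Plane) :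
    inner ℝ (u - z) (v - z) = dist z (midpoint ℝ u v) ^ 2 - (dist u v / 2) ^ 2 := by
  have hm : ∀ i, midpoint ℝ u v i = (u i + v i) / 2 := fun i => by
    simp [midpoint_eq_smul_add]; ring
  rw [div_pow, plane_dist_sq, plane_dist_sq, plane_inner, hm, hm]
  simp only [PiLp.sub_apply]
  ring

/-- The side opposite to an obtuse angle is longer than the other sides. -/
lemma dist_lt_dist_of_inner_neg {u v z : Plane} (h : inner ℝ (v - u) (z - u) < 0) :
    dist u v < dist v z := by
  refine lt_of_pow_lt_pow_left₀ 2 dist_nonneg ?_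
  rw [plane_inner] at h
  simp only [PiLp.sub_apply] at h
  rw [plane_dist_sq, plane_dist_sq]
  nlinarith [sq_nonneg (u 0 - z 0), sq_nonneg (u 1 - z 1)]

lemma dist_lt_dist_of_inner_nonpos_of_inner_neg {u v z w : Plane}
    (hz : inner ℝ (u - z) (v - z) ≤ 0) (hw : inner ℝ (u - w) (v - w) < 0) :
    dist z w < dist u v := by
  rw [inner_sub_sub_eq_dist_midpoint] at hz hw
  have h1 : dist z (midpoint ℝ u v) ≤ dist u v / 2 :=
    le_of_sq_le_sq (by linarith) (by positivity)
  have h2 : dist w (midpoint ℝ u v) < dist u v / 2 :=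
    lt_of_pow_lt_pow_left₀ 2 (by positivity) (by linarith)
  linarith [dist_triangle_right z w (midpoint ℝ u v)]

/-- The case of `dist_circumcenter_le` with circumcentre `0`, in coordinates. -/
lemma dist_circumcenter_le_aux {u0 u1 v0 v1 z0 z1 x0 x1 : ℝ}
    (hu : u0 ^ 2 + u1 ^ 2 = v0 ^ 2 + v1 ^ 2) (hz : z0 ^ 2 + z1 ^ 2 = v0 ^ 2 + v1 ^ 2)
    (hperp : x0 * (v0 - z0) + x1 * (v1 - z1) = 0)
    (hle : x0 * u0 + x1 * u1 ≤ x0 * v0 + x1 * v1)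
    (hob : v0 ^ 2 + v1 ^ 2 + (v0 * z0 + v1 * z1) < u0 * (v0 + z0) + u1 * (v1 + z1)) :
    x0 * v0 + x1 * v1 ≤ 0 := by
  have hne : (v0 - z0) ^ 2 + (v1 - z1) ^ 2 ≠ 0 := by
    intro h0
    have h1 : v0 - z0 = 0 := by nlinarith only [h0, sq_nonneg (v0 - z0), sq_nonneg (v1 - z1)]
    have h2 : v1 - z1 = 0 := by nlinarith only [h0, sq_nonneg (v0 - z0), sq_nonneg (v1 - z1)]
    rw [sub_eq_zero] at h1 h2
    subst h1 h2
    nlinarith only [hob, hu, sq_nonneg (u0 - v0), sq_nonneg (u1 - v1)]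
  -- both `x` and `v + z` are orthogonal to `v - z`, so they are parallel
  have hdet : x0 * (v1 + z1) - x1 * (v0 + z0) = 0 := by
    have : ((v0 - z0) ^ 2 + (v1 - z1) ^ 2) * (x0 * (v1 + z1) - x1 * (v0 + z0)) = 0 := by
      grind
    exact (mul_eq_zero.1 this).resolve_left hne
  have key : (x0 * v0 + x1 * v1) * (u0 * (v0 + z0) + u1 * (v1 + z1))
      = (x0 * u0 + x1 * u1) * (v0 ^ 2 + v1 ^ 2 + (v0 * z0 + v1 * z1)) := by
    linear_combination (v0 * u1 - v1 * u0) * hdet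
  have hm : 0 ≤ v0 ^ 2 + v1 ^ 2 + (v0 * z0 + v1 * z1) := by
    nlinarith only [hz, sq_nonneg (v0 + z0), sq_nonneg (v1 + z1)]
  by_contra! hpos
  linarith only [key, mul_le_mul_of_nonneg_right hle hm, mul_lt_mul_of_pos_left hob hpos]

/-- If the triangle `uvz` with circumcentre `c` is obtuse at `u`, then a point of the bisector of
`v` and `z` that is not closer to `u` than to `v` and `z` is at least as far from `v` as `c`: along
the bisector, towards the midpoint of `vz`, the vertex `u` enters the disc through `v` and `z`. -/
lemma dist_circumcenter_le {c u v z x : Plane} (hcu : dist c u = dist c v)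
    (hcz : dist c z = dist c v) (hxz : dist x z = dist x v) (hxu : dist x v ≤ dist x u)
    (h : inner ℝ (v - u) (z - u) < 0) : dist c v ≤ dist x v := by
  have hcu' := congrArg (· ^ 2) hcu
  have hcz' := congrArg (· ^ 2) hcz
  have hxz' := congrArg (· ^ 2) hxz
  have hxu' : dist x v ^ 2 ≤ dist x u ^ 2 := pow_le_pow_left₀ dist_nonneg hxu 2
  refine le_of_sq_le_sq ?_ dist_nonneg
  simp only [plane_dist_sq, plane_inner, PiLp.sub_apply] at *
  have key := dist_circumcenter_le_aux (u0 := u 0 - c 0) (u1 := u 1 - c 1) (v0 := v 0 - c 0)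
    (v1 := v 1 - c 1) (z0 := z 0 - c 0) (z1 := z 1 - c 1) (x0 := x 0 - c 0) (x1 := x 1 - c 1)
    (by linear_combination hcu') (by linear_combination hcz')
    (by linear_combination (hxz' - hcz') / 2) (by linear_combination (hxu' + hcu') / 2)
    (by linear_combination h - hcu')
  linear_combination 2 * key + sq_nonneg (x 0 - c 0) + sq_nonneg (x 1 - c 1)

/-- The case of `exists_inner_neg` with circumcentre `0`, in coordinates. -/
lemma exists_inner_neg_aux {a0 a1 b0 b1 d0 d1 q0 q1 : ℝ}
    (hb : b0 ^ 2 + b1 ^ 2 = a0 ^ 2 + a1 ^ 2) (hd : d0 ^ 2 + d1 ^ 2 = a0 ^ 2 + a1 ^ 2)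
    (pa : 0 < q0 * a0 + q1 * a1) (pb : 0 < q0 * b0 + q1 * b1) (pd : 0 < q0 * d0 + q1 * d1)
    (hab : 0 < (a0 - b0) ^ 2 + (a1 - b1) ^ 2) (had : 0 < (a0 - d0) ^ 2 + (a1 - d1) ^ 2)
    (hbd : 0 < (b0 - d0) ^ 2 + (b1 - d1) ^ 2)
    (hA : 0 ≤ (b0 - a0) * (d0 - a0) + (b1 - a1) * (d1 - a1))
    (hB : 0 ≤ (a0 - b0) * (d0 - b0) + (a1 - b1) * (d1 - b1))
    (hD : 0 ≤ (a0 - d0) * (b0 - d0) + (a1 - d1) * (b1 - d1)) : False := by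
  obtain ⟨A, hA'⟩ : ∃ A, A = (b0 - a0) * (d0 - a0) + (b1 - a1) * (d1 - a1) := ⟨_, rfl⟩
  obtain ⟨B, hB'⟩ : ∃ B, B = (a0 - b0) * (d0 - b0) + (a1 - b1) * (d1 - b1) := ⟨_, rfl⟩
  obtain ⟨D, hD'⟩ : ∃ D, D = (a0 - d0) * (b0 - d0) + (a1 - d1) * (b1 - d1) := ⟨_, rfl⟩
  obtain ⟨ab, hab'⟩ : ∃ y, y = (a0 - b0) ^ 2 + (a1 - b1) ^ 2 := ⟨_, rfl⟩
  obtain ⟨ad, had'⟩ : ∃ y, y = (a0 - d0) ^ 2 + (a1 - d1) ^ 2 := ⟨_, rfl⟩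
  obtain ⟨bd, hbd'⟩ : ∃ y, y = (b0 - d0) ^ 2 + (b1 - d1) ^ 2 := ⟨_, rfl⟩
  rw [← hA'] at hA
  rw [← hB'] at hB
  rw [← hD'] at hD
  rw [← hab'] at hab
  rw [← had'] at had
  rw [← hbd'] at hbd
  -- the barycentric coordinates of the circumcentre, up to a common factor
  have e0 : bd * A * a0 + ad * B * b0 + ab * D * d0 = 0 := by
    subst hA' hB' hD' hab' had' hbd'
    clear hab had hbd hA hB hD pa pb pd
    grind
  have e1 : bd * A * a1 + ad * B * b1 + ab * D * d1 = 0 := by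
    subst hA' hB' hD' hab' had' hbd'
    clear hab had hbd hA hB hD pa pb pd
    grind
  have hsum : bd * A * (q0 * a0 + q1 * a1) + ad * B * (q0 * b0 + q1 * b1)
      + ab * D * (q0 * d0 + q1 * d1) = 0 := by
    linear_combination q0 * e0 + q1 * e1
  have hAB : A + B = ab := by rw [hA', hB', hab']; ring
  have h1 : 0 ≤ bd * A * (q0 * a0 + q1 * a1) := by positivity
  have h2 : 0 ≤ ad * B * (q0 * b0 + q1 * b1) := by positivity
  have h3 : 0 ≤ ab * D * (q0 * d0 + q1 * d1) := by positivity
  rcases hA.lt_or_eq with hA0 | hA0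
  · have : 0 < bd * A * (q0 * a0 + q1 * a1) := by positivity
    linarith only [this, h2, h3, hsum]
  · have hB0 : 0 < B := by linarith only [hAB, hA0, hab]
    have : 0 < ad * B * (q0 * b0 + q1 * b1) := by positivity
    linarith only [this, h1, h3, hsum]

/-- Three distinct points on a circle of radius `R` that lie in a disc of radius less than `R`
form an obtuse triangle. With `c` the centre of the circle, nonnegative barycentric
coordinates of `c` in an acute or right triangle would put `c` in the convex hull of three points
that lie strictly on one side of a line through `c`. -/
lemma exists_inner_neg {c q a b d : Plane} {s : ℝ} (hab : a ≠ b)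
    (had : a ≠ d) (hbd : b ≠ d) (hcb : dist c b = dist c a) (hcd : dist c d = dist c a)
    (hqa : dist q a ≤ s) (hqb : dist q b ≤ s) (hqd : dist q d ≤ s) (hs : s < dist c a) :
    inner ℝ (b - a) (d - a) < 0 ∨ inner ℝ (a - b) (d - b) < 0 ∨ inner ℝ (a - d) (b - d) < 0 := by
  by_contra! hcon
  obtain ⟨hA, hB, hD⟩ := hcon
  have hcb' := congrArg (· ^ 2) hcb
  have hcd' := congrArg (· ^ 2) hcd
  have hqa' : dist q a ^ 2 < dist c a ^ 2 :=
    pow_lt_pow_left₀ (hqa.trans_lt hs) dist_nonneg two_ne_zero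
  have hqb' : dist q b ^ 2 < dist c a ^ 2 :=
    pow_lt_pow_left₀ (hqb.trans_lt hs) dist_nonneg two_ne_zero
  have hqd' : dist q d ^ 2 < dist c a ^ 2 :=
    pow_lt_pow_left₀ (hqd.trans_lt hs) dist_nonneg two_ne_zero
  have hab' : 0 < dist a b ^ 2 := pow_pos (dist_pos.2 hab) 2
  have had' : 0 < dist a d ^ 2 := pow_pos (dist_pos.2 had) 2
  have hbd' : 0 < dist b d ^ 2 := pow_pos (dist_pos.2 hbd) 2
  simp only [plane_dist_sq, plane_inner, PiLp.sub_apply] at *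
  have hq := sq_nonneg (q 0 - c 0)
  have hq' := sq_nonneg (q 1 - c 1)
  refine exists_inner_neg_aux (a0 := a 0 - c 0) (a1 := a 1 - c 1) (b0 := b 0 - c 0)
    (b1 := b 1 - c 1) (d0 := d 0 - c 0) (d1 := d 1 - c 1) (q0 := q 0 - c 0) (q1 := q 1 - c 1)
    ?_ ?_ ?_ ?_ ?_ ?_ ?_ ?_ ?_ ?_ ?_
  · linear_combination hcb'
  · linear_combination hcd'
  · linear_combination (hqa' + hq + hq') / 2
  · linear_combination (hqb' + hq + hq' - hcb') / 2
  · linear_combination (hqd' + hq + hq' - hcd') / 2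
  · linear_combination hab'
  · linear_combination had'
  · linear_combination hbd'
  · linear_combination hA
  · linear_combination hB
  · linear_combination hD

/-! ### Voronoi edges -/

lemma dist_eq_of_mem_voronoiCell {V : Finset Plane} {u v : V} {x : Plane}
    (hu : x ∈ voronoiCell V u) (hv : x ∈ voronoiCell V v) : dist x u = dist x v :=
  le_antisymm (hu v v.2) (hv u u.2)

lemma isClosed_voronoiCell (V : Finset Plane) (v : V) : IsClosed (voronoiCell V v) := by
  have : voronoiCell V v = ⋂ w ∈ V, {x : Plane | dist x (v : Plane) ≤ dist x w} := by
    ext x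
    simp [voronoiCell]
  rw [this]
  exact isClosed_biInter fun w _ => isClosed_le (by fun_prop) (by fun_prop)

/-- `dist x u ^ 2 - dist x w ^ 2` is an affine function of `x`. -/
lemma dist_sq_sub_dist_sq_lineMap (x y u w : Plane) (t : ℝ) :
    dist (AffineMap.lineMap x y t) u ^ 2 - dist (AffineMap.lineMap x y t) w ^ 2
      = (1 - t) * (dist x u ^ 2 - dist x w ^ 2) + t * (dist y u ^ 2 - dist y w ^ 2) := by
  have hm : ∀ i, (AffineMap.lineMap x y t : Plane) i = (1 - t) * x i + t * y i := fun i => by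
    simp [AffineMap.lineMap_apply]; ring
  simp only [plane_dist_sq, hm]
  ring

lemma lineMap_mem_voronoiCell {V : Finset Plane} {v : V} {x y : Plane}
    (hx : x ∈ voronoiCell V v) (hy : y ∈ voronoiCell V v) {t : ℝ} (h0 : 0 ≤ t) (h1 : t ≤ 1) :
    AffineMap.lineMap x y t ∈ voronoiCell V v := by
  intro w hw
  have e := dist_sq_sub_dist_sq_lineMap x y v w t
  have hx' := pow_le_pow_left₀ dist_nonneg (hx w hw) 2
  have hy' := pow_le_pow_left₀ dist_nonneg (hy w hw) 2
  refine le_of_sq_le_sq ?_ dist_nonneg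
  nlinarith [mul_nonneg (sub_nonneg.2 h1) (sub_nonneg.2 hx'), mul_nonneg h0 (sub_nonneg.2 hy')]

/-- The alpha radius of the edge `uv`: the radius of the smallest empty circle through `u` and
`v`, that is, the distance from `u` to the common part of the Voronoi cells of `u` and `v`. It is
only meaningful if these cells meet. -/
noncomputable def alphaRadius (V : Finset Plane) (u v : V) : ℝ :=
  Metric.infDist (u : Plane) (voronoiCell V u ∩ voronoiCell V v)

lemma alphaRadius_le {V : Finset Plane} {u v : V} {x : Plane} (hu : x ∈ voronoiCell V u)
    (hv : x ∈ voronoiCell V v) : alphaRadius V u v ≤ dist x u := by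
  rw [dist_comm]
  exact Metric.infDist_le_dist_of_mem ⟨hu, hv⟩

lemma exists_alphaRadius_eq {V : Finset Plane} {u v : V}
    (h : (voronoiCell V u ∩ voronoiCell V v).Nonempty) :
    ∃ x, x ∈ voronoiCell V u ∧ x ∈ voronoiCell V v ∧ alphaRadius V u v = dist x u := by
  obtain ⟨x, hx, hd⟩ := IsClosed.exists_infDist_eq_dist
    ((isClosed_voronoiCell V u).inter (isClosed_voronoiCell V v)) h (u : Plane)
  exact ⟨x, hx.1, hx.2, by rw [dist_comm x]; exact hd⟩

lemma eq_of_dist_eq_alphaRadius {V : Finset Plane} {u v : V} {x y : Plane}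
    (hxu : x ∈ voronoiCell V u) (hxv : x ∈ voronoiCell V v) (hyu : y ∈ voronoiCell V u)
    (hyv : y ∈ voronoiCell V v) (hx : alphaRadius V u v = dist x u)
    (hy : alphaRadius V u v = dist y u) : x = y := by
  -- otherwise the midpoint of `x` and `y` would be nearer
  have h := alphaRadius_le
    (lineMap_mem_voronoiCell hxu hyu (t := 1 / 2) (by norm_num) (by norm_num))
    (lineMap_mem_voronoiCell hxv hyv (by norm_num) (by norm_num))
  rw [hx] at h
  have h' := pow_le_pow_left₀ dist_nonneg h 2
  have hxy := congrArg (· ^ 2) (hx.symm.trans hy)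
  have hm : ∀ i, (AffineMap.lineMap x y (1 / 2 : ℝ) : Plane) i = (x i + y i) / 2 := fun i => by
    simp [AffineMap.lineMap_apply]; ring
  rw [← dist_eq_zero, ← sq_eq_zero_iff]
  refine le_antisymm ?_ (sq_nonneg _)
  simp only [plane_dist_sq, hm] at *
  linarith

/-- If no empty circle through `u` and `v` has `uv` as a diameter, then the smallest empty circle
through `u` and `v` passes through a further point `w` of `V`, which has an obtuse angle over `uv`:
the point `w` is what prevents moving the centre of the circle towards the midpoint of `uv`. -/
lemma exists_apex {V : Finset Plane} {u v : V}
    (h : (voronoiCell V u ∩ voronoiCell V v).Nonempty)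
    (hfar : ∀ x ∈ voronoiCell V u, x ∈ voronoiCell V v → dist (u : Plane) v / 2 < dist x u) :
    ∃ x, x ∈ voronoiCell V u ∧ x ∈ voronoiCell V v ∧ alphaRadius V u v = dist x u ∧
      ∃ w : V, x ∈ voronoiCell V w ∧ inner ℝ ((u : Plane) - w) ((v : Plane) - w) < 0 := by
  obtain ⟨x, hxu, hxv, hx⟩ := exists_alphaRadius_eq h
  refine ⟨x, hxu, hxv, hx, ?_⟩
  by_contra! hcon
  set m := midpoint ℝ (u : Plane) v with hm
  have hmu : dist m u = dist (u : Plane) v / 2 := by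
    rw [hm, dist_midpoint_left]; norm_num; ring
  have hmv : dist m v = dist (u : Plane) v / 2 := by
    rw [hm, dist_midpoint_right]; norm_num; ring
  -- a point slightly nearer to the midpoint still belongs to both cells
  have hev : ∀ᶠ t in nhdsWithin (0 : ℝ) (Set.Ioi 0), ∀ w ∈ V,
      dist (AffineMap.lineMap x m t) (u : Plane) ^ 2 ≤ dist (AffineMap.lineMap x m t) w ^ 2 := by
    rw [Filter.eventually_all_finset]
    intro w hw
    rcases (hxu w hw).lt_or_eq with hlt | heq
    · have hc : Filter.Tendsto (fun t : ℝ => dist (AffineMap.lineMap x m t) w ^ 2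
          - dist (AffineMap.lineMap x m t) (u : Plane) ^ 2) (nhdsWithin (0 : ℝ) (Set.Ioi 0))
          (nhds (dist (AffineMap.lineMap x m (0 : ℝ)) w ^ 2
          - dist (AffineMap.lineMap x m (0 : ℝ)) (u : Plane) ^ 2)) := by
        refine (Continuous.tendsto ?_ 0).mono_left nhdsWithin_le_nhds
        have : Continuous fun t : ℝ => (AffineMap.lineMap x m t : Plane) :=
          AffineMap.lineMap_continuous
        fun_prop
      have hpos : 0 < dist (AffineMap.lineMap x m (0 : ℝ)) w ^ 2
          - dist (AffineMap.lineMap x m (0 : ℝ)) (u : Plane) ^ 2 := by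
        rw [AffineMap.lineMap_apply_zero, sub_pos]
        exact pow_lt_pow_left₀ hlt dist_nonneg two_ne_zero
      filter_upwards [hc.eventually_const_lt hpos] with t ht
      linarith
    · filter_upwards [self_mem_nhdsWithin] with t ht
      have hxw : x ∈ voronoiCell V ⟨w, hw⟩ := fun y hy => by
        rw [← show dist x u = dist x w from heq]; exact hxu y hy
      have h1 := hcon ⟨w, hw⟩ hxw
      rw [inner_sub_sub_eq_dist_midpoint, ← hm, ← hmu, dist_comm w] at h1
      have e := dist_sq_sub_dist_sq_lineMap x m u w t
      rw [heq] at e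
      nlinarith [mul_nonneg (le_of_lt (Set.mem_Ioi.1 ht)) h1]
  obtain ⟨t, ht, ht0, ht1⟩ := (hev.and (Ioo_mem_nhdsGT zero_lt_one)).exists
  have hyu : AffineMap.lineMap x m t ∈ voronoiCell V u := fun w hw =>
    le_of_sq_le_sq (ht w hw) dist_nonneg
  have e := dist_sq_sub_dist_sq_lineMap x m u v t
  rw [dist_eq_of_mem_voronoiCell hxu hxv, hmu, hmv] at e
  have hyv : AffineMap.lineMap x m t ∈ voronoiCell V v := fun w hw =>
    le_of_sq_le_sq (by have := ht w hw; linarith) dist_nonneg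
  have h1 := alphaRadius_le hyu hyv
  have h2 : dist (AffineMap.lineMap x m t) (u : Plane) ≤ (1 - t) * dist x u + t * dist m u := by
    have := (convexOn_univ_dist (u : Plane)).2 (Set.mem_univ x) (Set.mem_univ m)
      (sub_nonneg.2 ht1.le) ht0.le (by ring)
    rw [AffineMap.lineMap_apply_module]
    exact this
  have h3 := hfar x hxu hxv
  rw [hx] at h1
  nlinarith

/-! ### Bad edges -/

lemma mem_nerveComplex_faces {ι X : Type*} {C : ι → Set X} {s : Finset ι} :
    s ∈ (nerveComplex C).faces ↔ s.Nonempty ∧ ∃ x, ∀ i ∈ s, x ∈ C i := by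
  simp only [nerveComplex, Set.mem_ofPred_eq, Set.Nonempty, Set.mem_iInter]

lemma mem_delaunayCechComplex_faces {V : Finset Plane} {r : ℝ} {σ : Finset V} :
    σ ∈ (delaunayCechComplex V r).faces ↔ σ.Nonempty ∧ (∃ c, ∀ v ∈ σ, c ∈ voronoiCell V v) ∧
      ∃ q, ∀ v ∈ σ, dist q (v : Plane) ≤ r / 2 := by
  have h : σ ∈ (delaunayCechComplex V r).faces ↔
      σ ∈ (nerveComplex (voronoiCell V)).faces ∧ σ ∈ (cechComplex V r).faces := by
    rw [← delaunayComplex_eq_nerveComplex_voronoiCell]; rfl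
  rw [h, cechComplex, mem_nerveComplex_faces, mem_nerveComplex_faces]
  simp only [Metric.mem_closedBall]
  exact ⟨fun h => ⟨h.1.1, h.1.2, h.2.2⟩, fun h => ⟨⟨h.1, h.2.1⟩, h.1, h.2.2⟩⟩

lemma mem_alphaComplex_faces {V : Finset Plane} {r : ℝ} {σ : Finset V} :
    σ ∈ (alphaComplex V r).faces ↔ σ.Nonempty ∧
      ∃ c, ∀ v ∈ σ, c ∈ voronoiCell V v ∧ dist c (v : Plane) ≤ r / 2 := by
  rw [alphaComplex, mem_nerveComplex_faces]
  simp only [alphaCell, Set.mem_inter_iff, Metric.mem_closedBall]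

/-- An edge `uv` is bad if it belongs to the Delaunay–Čech complex but not to the alpha complex:
it is short and lies on an empty circle, but every empty circle through `u` and `v` is large. -/
def IsBadEdge (V : Finset Plane) (r : ℝ) (u v : V) : Prop :=
  u ≠ v ∧ dist (u : Plane) v ≤ r ∧ (voronoiCell V u ∩ voronoiCell V v).Nonempty ∧
    ∀ x ∈ voronoiCell V u, x ∈ voronoiCell V v → r / 2 < dist x (u : Plane)

/-- The side opposite to an obtuse angle of a Delaunay triangle with large circumradius is a bad
edge, and its alpha radius is the circumradius. -/
lemma isBadEdge_of_inner_neg {V : Finset Plane} {r : ℝ} {u v z : V} {c : Plane}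
    (hu : c ∈ voronoiCell V u) (hv : c ∈ voronoiCell V v) (hz : c ∈ voronoiCell V z)
    (hvz : v ≠ z) (hr : dist (v : Plane) z ≤ r) (hc : r / 2 < dist c (v : Plane))
    (h : inner ℝ ((v : Plane) - u) ((z : Plane) - u) < 0) :
    IsBadEdge V r v z ∧ alphaRadius V v z = dist c (v : Plane) := by
  have key : ∀ x ∈ voronoiCell V v, x ∈ voronoiCell V z → dist c (v : Plane) ≤ dist x v :=
    fun x hxv hxz => dist_circumcenter_le (dist_eq_of_mem_voronoiCell hu hv)
      (dist_eq_of_mem_voronoiCell hz hv) (dist_eq_of_mem_voronoiCell hxz hxv) (hxv u u.2) h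
  refine ⟨⟨hvz, hr, ⟨c, hv, hz⟩, fun x hxv hxz => hc.trans_le (key x hxv hxz)⟩, ?_⟩
  obtain ⟨x, hxv, hxz, hx⟩ := exists_alphaRadius_eq ⟨c, hv, hz⟩
  exact le_antisymm (alphaRadius_le hv hz) (hx ▸ key x hxv hxz)

lemma dist_le_of_dist_le_half {q u v : Plane} {r : ℝ} (hu : dist q u ≤ r / 2)
    (hv : dist q v ≤ r / 2) : dist u v ≤ r := by
  linarith [dist_triangle_left u v q]

/-- The alpha complex consists of the faces of the Delaunay–Čech complex without bad edges. -/
lemma mem_alphaComplex_faces_iff {V : Finset Plane} {r : ℝ} (hr : 0 < r) {σ : Finset V} :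
    σ ∈ (alphaComplex V r).faces ↔ σ ∈ (delaunayCechComplex V r).faces ∧
      ∀ u ∈ σ, ∀ v ∈ σ, ¬ IsBadEdge V r u v := by
  rw [mem_alphaComplex_faces, mem_delaunayCechComplex_faces]
  constructor
  · rintro ⟨hσ, c, hc⟩
    refine ⟨⟨hσ, ⟨c, fun v hv => (hc v hv).1⟩, c, fun v hv => (hc v hv).2⟩, ?_⟩
    rintro u hu v hv ⟨-, -, -, h⟩
    exact absurd (hc u hu).2 (h c (hc u hu).1 (hc v hv).1).not_ge
  · rintro ⟨⟨hσ, ⟨c, hc⟩, q, hq⟩, hgood⟩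
    refine ⟨hσ, ?_⟩
    have hlen : ∀ u ∈ σ, ∀ v ∈ σ, dist (u : Plane) v ≤ r := fun u hu v hv =>
      dist_le_of_dist_le_half (hq u hu) (hq v hv)
    by_cases h3 : 2 < σ.card
    · obtain ⟨a, ha, b, hb, d, hd, hab, had, hbd⟩ := Finset.two_lt_card.1 h3
      have hdist : ∀ v ∈ σ, dist c (v : Plane) = dist c a := fun v hv =>
        dist_eq_of_mem_voronoiCell (hc v hv) (hc a ha)
      rcases le_or_gt (dist c (a : Plane)) (r / 2) with hle | hgt
      · exact ⟨c, fun v hv => ⟨hc v hv, (hdist v hv).trans_le hle⟩⟩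
      · exfalso
        rcases exists_inner_neg (Subtype.coe_injective.ne hab) (Subtype.coe_injective.ne had)
          (Subtype.coe_injective.ne hbd) (hdist b hb) (hdist d hd) (hq a ha) (hq b hb) (hq d hd)
          hgt with h | h | h
        · exact hgood b hb d hd (isBadEdge_of_inner_neg (hc a ha) (hc b hb) (hc d hd) hbd
            (hlen b hb d hd) (by rwa [hdist b hb]) h).1
        · exact hgood a ha d hd (isBadEdge_of_inner_neg (hc b hb) (hc a ha) (hc d hd) had
            (hlen a ha d hd) hgt h).1
        · exact hgood a ha b hb (isBadEdge_of_inner_neg (hc d hd) (hc a ha) (hc b hb) hab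
            (hlen a ha b hb) hgt h).1
    · obtain ⟨u, hu⟩ := hσ
      by_cases h1 : ∃ v ∈ σ, u ≠ v
      · obtain ⟨v, hv, huv⟩ := h1
        have hσ' : ∀ w ∈ σ, w = u ∨ w = v := by
          intro w hw
          by_contra! hne
          exact h3 (Finset.two_lt_card.2 ⟨u, hu, v, hv, w, hw, huv, hne.1.symm, hne.2.symm⟩)
        have hn := hgood u hu v hv
        simp only [IsBadEdge, not_and, not_forall, not_lt] at hn
        obtain ⟨x, hxu, hxv, hx⟩ := hn huv (hlen u hu v hv) ⟨c, hc u hu, hc v hv⟩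
        refine ⟨x, fun w hw => ?_⟩
        rcases hσ' w hw with rfl | rfl
        · exact ⟨hxu, hx⟩
        · exact ⟨hxv, dist_eq_of_mem_voronoiCell hxv hxu ▸ hx⟩
      · push Not at h1
        refine ⟨u, fun w hw => ?_⟩
        rw [← h1 w hw, dist_self]
        exact ⟨fun y _ => by rw [dist_self]; exact dist_nonneg, by positivity⟩

/-! ### Removing the bad edges one after the other -/

/-- The subcomplex of the faces of `K` that do not contain any of the given edges, which are
written as ordered pairs of vertices. -/
def deleteEdges {ι : Type*} (K : PreAbstractSimplicialComplex ι) (S : Finset (ι × ι)) :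
    PreAbstractSimplicialComplex ι where
  faces := {σ | σ ∈ K.faces ∧ ∀ p ∈ S, p.1 ∈ σ → p.2 ∉ σ}
  isRelLowerSet_faces := by
    rintro s ⟨hs, h⟩
    exact ⟨(K.isRelLowerSet_faces hs).1, fun t hts ht => ⟨(K.isRelLowerSet_faces hs).2 hts ht,
      fun p hp h1 h2 => h p hp (hts h1) (hts h2)⟩⟩

/-- Edges are compared by their alpha radius, and by their length if the alpha radii agree. -/
noncomputable def edgeKey (V : Finset Plane) (p : V × V) : ℝ ×ₗ ℝ :=
  toLex (alphaRadius V p.1 p.2, dist (p.1 : Plane) p.2)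

/-- Suppose that all bad edges with a larger key than the bad edge `uv` have been removed, but no
edge with a smaller key. Then the link of `uv` is a cone. -/
lemma exists_cone_apex {V : Finset Plane} {r : ℝ} {u v : V} {S : Finset (V × V)}
    [DecidableEq V] (huv : IsBadEdge V r u v)
    (hS : ∀ p ∈ S, IsBadEdge V r p.1 p.2 ∧ edgeKey V (u, v) ≤ edgeKey V p)
    (hS' : ∀ p : V × V, IsBadEdge V r p.1 p.2 → edgeKey V (u, v) < edgeKey V p → p ∈ S) :
    ∃ w, w ∉ ({u, v} : Finset V) ∧ ∀ σ ∈ (deleteEdges (delaunayCechComplex V r) S).faces,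
      {u, v} ⊆ σ → insert w σ ∈ (deleteEdges (delaunayCechComplex V r) S).faces := by
  obtain ⟨hne, hlen, hcell, hfar⟩ := huv
  obtain ⟨x, hxu, hxv, hx, w, hxw, hw⟩ := exists_apex hcell fun y hyu hyv =>
    (div_le_div_of_nonneg_right hlen zero_le_two).trans_lt (hfar y hyu hyv)
  refine ⟨w, ?_, ?_⟩
  · intro hmem
    rw [Finset.mem_insert, Finset.mem_singleton] at hmem
    rcases hmem with rfl | rfl <;> simp at hw
  rintro σ ⟨hσ, havoid⟩ huvσ
  have hu : u ∈ σ := huvσ (by simp)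
  have hv : v ∈ σ := huvσ (by simp)
  rw [mem_delaunayCechComplex_faces] at hσ
  obtain ⟨-, ⟨c, hc⟩, q, hq⟩ := hσ
  have hcR := hfar c (hc u hu) (hc v hv)
  have hcv : dist c (v : Plane) = dist c u := dist_eq_of_mem_voronoiCell (hc v hv) (hc u hu)
  have hρ : alphaRadius V u v ≤ dist c (u : Plane) := alphaRadius_le (hc u hu) (hc v hv)
  -- a triangle over `uv` with another longest side has lost that side already
  have hlong : ∀ a b : V, a ∈ σ → b ∈ σ → IsBadEdge V r a b →
      alphaRadius V a b = dist c (u : Plane) → ¬ dist (u : Plane) v < dist (a : Plane) b := by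
    intro a b ha hb hab hrad hl
    refine havoid (a, b) (hS' (a, b) hab ?_) ha hb
    rw [edgeKey, edgeKey, Prod.Lex.toLex_lt_toLex]
    simp only [hrad]
    exact hρ.lt_or_eq.imp id fun h => ⟨h, hl⟩
  have hobtuse : ∀ z ∈ σ, u ≠ z → v ≠ z → inner ℝ ((u : Plane) - z) ((v : Plane) - z) < 0 := by
    intro z hz huz hvz
    rcases exists_inner_neg (Subtype.coe_injective.ne hne) (Subtype.coe_injective.ne huz)
      (Subtype.coe_injective.ne hvz) hcv (dist_eq_of_mem_voronoiCell (hc z hz) (hc u hu))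
      (hq u hu) (hq v hv) (hq z hz) hcR with h | h | h
    · obtain ⟨h1, h2⟩ := isBadEdge_of_inner_neg (hc u hu) (hc v hv) (hc z hz) hvz
        (dist_le_of_dist_le_half (hq v hv) (hq z hz)) (by rwa [hcv]) h
      exact absurd (dist_lt_dist_of_inner_neg h) (hlong v z hv hz h1 (h2.trans hcv))
    · obtain ⟨h1, h2⟩ := isBadEdge_of_inner_neg (hc v hv) (hc u hu) (hc z hz) huz
        (dist_le_of_dist_le_half (hq u hu) (hq z hz)) hcR h
      have h3 := dist_lt_dist_of_inner_neg h
      rw [dist_comm (v : Plane)] at h3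
      exact absurd h3 (hlong u z hu hz h1 h2)
    · exact h
  have hnonpos : ∀ z ∈ insert w σ, inner ℝ ((u : Plane) - z) ((v : Plane) - z) ≤ 0 := by
    intro z hz
    rcases Finset.mem_insert.1 hz with rfl | hz
    · exact hw.le
    by_cases huz : u = z
    · simp [huz]
    by_cases hvz : v = z
    · simp [hvz]
    exact (hobtuse z hz huz hvz).le
  have hxσ : ∀ z ∈ insert w σ, x ∈ voronoiCell V z := by
    intro z hz
    rcases Finset.mem_insert.1 hz with rfl | hz
    · exact hxw
    by_cases huz : u = z
    · exact huz ▸ hxu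
    by_cases hvz : v = z
    · exact hvz ▸ hxv
    -- the circumcentre of `uvz` is the centre `x` of the smallest empty circle through `u`, `v`
    have h2 := (isBadEdge_of_inner_neg (hc z hz) (hc u hu) (hc v hv) hne hlen hcR
      (hobtuse z hz huz hvz)).2
    rw [eq_of_dist_eq_alphaRadius hxu hxv (hc u hu) (hc v hv) hx h2]
    exact hc z hz
  -- an edge at `w` has at most the alpha radius of `uv`, and it is shorter
  have hnot : ∀ a b : V, x ∈ voronoiCell V a → x ∈ voronoiCell V b →
      dist (a : Plane) b < dist (u : Plane) v → (a, b) ∉ S := by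
    intro a b ha hb hl hab
    have h1 := (hS _ hab).2
    rw [edgeKey, edgeKey, Prod.Lex.toLex_le_toLex] at h1
    have h2 : alphaRadius V a b ≤ alphaRadius V u v := by
      rw [hx, ← dist_eq_of_mem_voronoiCell ha hxu]
      exact alphaRadius_le ha hb
    rcases h1 with h1 | h1
    · exact absurd h1 h2.not_gt
    · exact absurd h1.2 hl.not_ge
  refine ⟨mem_delaunayCechComplex_faces.2 ⟨Finset.insert_nonempty _ _, ⟨x, hxσ⟩,
    midpoint ℝ (u : Plane) v, fun z hz => ?_⟩, ?_⟩
  · have h := hnonpos z hz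
    rw [inner_sub_sub_eq_dist_midpoint] at h
    rw [dist_comm]
    refine le_trans ?_ (div_le_div_of_nonneg_right hlen zero_le_two)
    exact le_of_sq_le_sq (by linarith) (by positivity)
  · rintro ⟨a, b⟩ hp ha hb
    have hab : a ≠ b := (hS _ hp).1.1
    rcases Finset.mem_insert.1 ha with rfl | ha'
    · refine hnot a b (hxσ a ha) (hxσ b hb) ?_ hp
      rw [dist_comm]
      exact dist_lt_dist_of_inner_nonpos_of_inner_neg (hnonpos b hb) hw
    rcases Finset.mem_insert.1 hb with rfl | hb'
    · exact hnot a b (hxσ a ha) (hxσ b hb)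
        (dist_lt_dist_of_inner_nonpos_of_inner_neg (hnonpos a ha) hw) hp
    exact havoid _ hp ha' hb'

/-- If `S` contains, with a bad edge, all bad edges with a larger key, then removing the edges in
`S` does not change the homotopy type. -/
lemma nonempty_homotopyEquiv_deleteEdges (V : Finset Plane) (r : ℝ) (S : Finset (V × V))
    (hS : ∀ p ∈ S, IsBadEdge V r p.1 p.2)
    (hS' : ∀ p ∈ S, ∀ p' : V × V, IsBadEdge V r p'.1 p'.2 → edgeKey V p < edgeKey V p' → p' ∈ S) :
    Nonempty (ContinuousMap.HomotopyEquiv (geomRealization (delaunayCechComplex V r))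
      (geomRealization (deleteEdges (delaunayCechComplex V r) S))) := by
  classical
  induction S using Finset.induction_on_min_value (edgeKey V) with
  | empty =>
    have : deleteEdges (delaunayCechComplex V r) ∅ = delaunayCechComplex V r := by
      ext σ
      simp [deleteEdges]
    rw [this]
    exact ⟨.refl _⟩
  | insert p S hp hmin ih =>
    obtain ⟨e⟩ := ih (fun p' hp' => hS p' (Finset.mem_insert_of_mem hp'))
      fun p₁ hp₁ p₂ hp₂ hlt => Finset.mem_of_mem_insert_of_ne
        (hS' p₁ (Finset.mem_insert_of_mem hp₁) p₂ hp₂ hlt)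
        fun h => ((hmin p₁ hp₁).trans_lt hlt).ne (by rw [h])
    obtain ⟨w, hw, hcone⟩ := exists_cone_apex (hS p (Finset.mem_insert_self _ _)) (S := S)
      (fun p' hp' => ⟨hS p' (Finset.mem_insert_of_mem hp'), hmin p' hp'⟩)
      fun p' hp' hlt => Finset.mem_of_mem_insert_of_ne
        (hS' p (Finset.mem_insert_self _ _) p' hp' hlt) fun h => hlt.ne (by rw [h])
    obtain ⟨e'⟩ := nonempty_homotopyEquiv_of_remove_star
      (deleteEdges (delaunayCechComplex V r) S)
      (deleteEdges (delaunayCechComplex V r) (insert p S)) (Finset.insert_nonempty _ _) hw hcone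
      fun σ => by
        simp only [deleteEdges, Set.mem_ofPred_eq, Finset.forall_mem_insert,
          Finset.insert_subset_iff, Finset.singleton_subset_iff, not_and]
        tauto
    exact ⟨e.trans e'⟩

theorem mainTheorem1 (V : Finset Plane) (r : ℝ) (hr : 0 < r) :
    Nonempty (ContinuousMap.HomotopyEquiv
      (geomRealization (delaunayCechComplex V r)) (geomRealization (alphaComplex V r))) := by
  classical
  have h := nonempty_homotopyEquiv_deleteEdges V r
    (Finset.univ.filter fun p => IsBadEdge V r p.1 p.2) (fun p hp => (Finset.mem_filter.1 hp).2)
    fun _ _ p' hp' _ => Finset.mem_filter.2 ⟨Finset.mem_univ _, hp'⟩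
  have heq : deleteEdges (delaunayCechComplex V r)
      (Finset.univ.filter fun p => IsBadEdge V r p.1 p.2) = alphaComplex V r := by
    ext σ
    rw [mem_alphaComplex_faces_iff hr]
    simp only [deleteEdges, Set.mem_ofPred_eq, Finset.mem_filter, Finset.mem_univ, true_and,
      Prod.forall]
    grind
  rwa [heq] at h
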